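/- For $A\ge 0$ let $E_A$ be the space of locally integrable functions $f:[0,\infty)\to\mathbb R$ with $|f(t)|\le Ke^{At}$ for all $t\ge 0$ and some constant $K>0$, and let $E=\bigcup_{A\ge 0}E_A$. Put $s_{n,k}(x)=\frac{(nx)^k}{k!}e^{-nx}$ for integers $k\ge 0$ and $s_{n,k}=0$ for $k<0$. For $j\in\mathbb Z$, $f\in E_A$ and integers $n>A$ define $$(S_{n,j}f)(x)=f(0)\sum_{k=0}^{j-1}s_{n,k}(x)+\sum_{k=j}^{\infty}s_{n,k}(x)\,n\int_0^\infty s_{n,k-j}(t)f(t)\,dt ,$$ where a sum is zero if its upper limit is smaller than its lower limit. For an integer $k\ge 1$ let $(\mathcal D_j^{2k}f)(x)=x^j\bigl(x^{k-j}f^{(k)}(x)\bigr)^{(k)}$, and let $\mathcal D_j^{0}$ be the identity. A function $f$ admits the derivative $f^{(N)}(x)$, $N\ge 1$, if $f^{(N-1)}$ exists in a neighbourhood of $x$ and is differentiable at $x$; for $N=0$ this is no condition. **Theorem.** Let $j\in\mathbb Z$, let $x>0$ and let $q,m$ be non-negative integers. Suppose that $f\in E$ admits the derivative $f^{(2q+2m)}(x)$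 and, in the case $q=m=0$, that $f$ is continuous at $x$. Then: 1. If $f\in E_A$ with $A\ge 0$, then for every integer $n>A$ the integrals defining $S_{n,j}f$ converge absolutely, the series defining it converges absolutely at every point of $[0,\infty)$, and $S_{n,j}f$ has an $m$-th derivative at $x$. 2. As $n\to\infty$, $$(S_{n,j}f)^{(m)}(x)=\sum_{k=0}^{q}c_{k,j}^{(m)}(f,x)\,n^{-k}+o(n^{-q}),$$ where, for $0\le k\le q$, $$c_{k,j}(f,x)=\frac1{k!}\bigl(\mathcal D_j^{2k}f\bigr)(x)=\frac{1}{k!}\,x^{j}\bigl(x^{k-j}f^{(k)}(x)\bigr)^{(k)}$$ and $c_{k,j}^{(m)}(f,x)$ is the $m$-th derivative of $c_{k,j}(f,\cdot)$ at $x$; all derivatives occurring here exist. 3. In explicit form, for $0\le k\le q$, $$c_{k,j}^{(m)}(f,x)=\sum_{i=0}^{k}\frac{1}{i!}\binom{k+m-j}{k-i}x^{i}f^{(k+m+i)}(x),$$ so that, as $n\to\infty$, $$(S_{n,j}f)^{(m)}(x)=\sum_{k=0}^{q}\frac1{n^{k}}\sum_{i=0}^{k}\frac{1}{i!}\binom{k+m-j}{k-i}x^{i}f^{(k+m+i)}(x)+o(n^{-q}).$$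 Here $\binom{a}{r}=\frac{a(a-1)\cdots(a-r+1)}{r!}$ for every integer $a$ and $r\ge 0$. -/

import Mathlib

open Filter Topology Asymptotics MeasureTheory

/-- The Szász basis function `s_{n,k}(x) = (n x)^k / k! * e^{-n x}` for `k ≥ 0`, and `0` for
`k < 0`. -/
noncomputable def szaszBasis (n : ℕ) (k : ℤ) (x : ℝ) : ℝ :=
  if k < 0 then 0
  else ((n : ℝ) * x) ^ k.toNat / (k.toNat.factorial : ℝ) * Real.exp (-((n : ℝ) * x))

/-- The class `E_A`: locally integrable functions on `[0, ∞)` with `|f t| ≤ K e^{A t}` for some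
`K > 0`. A function on `[0, ∞)` is represented by a function on `ℝ` of which only the values on
`[0, ∞)` are ever used. -/
def ExpGrowth (A : ℝ) (f : ℝ → ℝ) : Prop :=
  LocallyIntegrableOn f (Set.Ici 0) ∧
    ∃ K : ℝ, 0 < K ∧ ∀ t : ℝ, 0 ≤ t → |f t| ≤ K * Real.exp (A * t)

/-- The class `E`, the union of the `E_A` over `A ≥ 0`. -/
def MemE (f : ℝ → ℝ) : Prop :=
  ∃ A : ℝ, 0 ≤ A ∧ ExpGrowth A f

/-- The summand with index `k` of the infinite series in the definition of `S_{n,j} f` :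
`s_{n,k}(x) * n * ∫_0^∞ s_{n,k-j}(t) f(t) dt`. -/
noncomputable def szaszTerm (n : ℕ) (j : ℤ) (f : ℝ → ℝ) (x : ℝ) (k : ℤ) : ℝ :=
  szaszBasis n k x * ((n : ℝ) * ∫ t in Set.Ioi (0 : ℝ), szaszBasis n (k - j) t * f t)

/-- The operator
`(S_{n,j} f)(x) = f(0) ∑_{k=0}^{j-1} s_{n,k}(x)
  + ∑_{k=j}^∞ s_{n,k}(x) n ∫_0^∞ s_{n,k-j}(t) f(t) dt`;
the infinite series is indexed by `k = j + i`, `i = 0, 1, 2, …`. -/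
noncomputable def szaszOp (n : ℕ) (j : ℤ) (f : ℝ → ℝ) (x : ℝ) : ℝ :=
  f 0 * (∑ k ∈ Finset.range j.toNat, szaszBasis n (k : ℤ) x)
    + ∑' i : ℕ, szaszTerm n j f x (j + (i : ℤ))

/-- The integrals and the series in the definition of `S_{n,j} f` converge (absolutely). -/
def SzaszOpDefined (n : ℕ) (j : ℤ) (f : ℝ → ℝ) : Prop :=
  (∀ k : ℤ, j ≤ k → IntegrableOn (fun t => szaszBasis n (k - j) t * f t) (Set.Ioi (0 : ℝ))) ∧
    ∀ x : ℝ, 0 ≤ x → Summable (fun i : ℕ => szaszTerm n j f x (j + (i : ℤ)))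

/-- `f` admits the derivative `f^{(N)}(x)`: the derivative of order `N - 1` exists in a
neighbourhood of `x` and is differentiable at `x` (no condition for `N = 0`). -/
def AdmitsDeriv : ℕ → (ℝ → ℝ) → ℝ → Prop
  | 0, _, _ => True
  | N + 1, f, x => (∀ᶠ y in 𝓝 x, AdmitsDeriv N f y) ∧ DifferentiableAt ℝ (iteratedDeriv N f) x

/-- The differential operator `𝒟_j^{2k} = e_j D^k (e_{k-j} D^k)` for `k ≥ 1`, where
`e_r(t) = t^r`, and the identity for `k = 0`. -/
noncomputable def szaszDiffOp (j : ℤ) (k : ℕ) (f : ℝ → ℝ) (x : ℝ) : ℝ :=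
  if k = 0 then f x
  else x ^ j * iteratedDeriv k (fun t : ℝ => t ^ ((k : ℤ) - j) * iteratedDeriv k f t) x

/-- The coefficient `c_{k,j}(f, x) = (1 / k!) (𝒟_j^{2k} f)(x)`. -/
noncomputable def szaszCoeff (k : ℕ) (j : ℤ) (f : ℝ → ℝ) (x : ℝ) : ℝ :=
  1 / (k.factorial : ℝ) * szaszDiffOp j k f x

/-- `∑_{i=0}^k (1 / i!) C(k+m-j, k-i) x^i f^{(k+m+i)}(x)`, with the generalized binomial
coefficient of a possibly negative integer. -/
noncomputable def szaszExplicitCoeff (k m : ℕ) (j : ℤ) (f : ℝ → ℝ) (x : ℝ) : ℝ :=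
  ∑ i ∈ Finset.range (k + 1),
    1 / (i.factorial : ℝ) * ((Ring.choose ((k : ℤ) + (m : ℤ) - j) (k - i) : ℤ) : ℝ) * x ^ i *
      iteratedDeriv (k + m + i) f x

/-!
The operator is an exponential generating function. Put `β i = n ∫ s_{n,i} f` for `i ≥ 0` and
`β i = f 0` for `i < 0`. For every integer `j`, of either sign, `S_{n,j} f (y)` is then the series
`∑_{k ≥ 0} s_{n,k}(y) β (k - j)`, and `|β (k - j)|` grows at most geometrically in `k`
(`ExpGrowth.szaszOp_eq`). Since `s_{n,k}' = n (s_{n,k-1} - s_{n,k})`, termwise differentiation gives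
`(S_{n,j} f)' = n (S_{n,j-1} f - S_{n,j} f)` (`ExpGrowth.hasDerivAt_szaszOp`).

By Pascal's rule the explicit coefficients satisfy the matching recursion
(`szaszExplicitCoeff_sub`). So the expansion of order `q` of the derivative of order `m` follows,
by induction on `m` and for all `j` at once, from the expansion of order `q + m` of the operators
themselves, which uses the `2 q + 2 m` derivatives of `f` at `x`.

For `m = 0`, write `f = T + R` with `T` the Taylor polynomial of degree `2 q` at `x`; Peano's form of
the remainder (`AdmitsDeriv.taylor_isLittleO`) gives `R = o((t - x)^{2q})`. On monomials `β i` is a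
polynomial in `i`, and Vandermonde's identity evaluates the series exactly, up to finitely many
terms `s_{n,k}(x)` with `k < j`, which decay exponentially (`szaszOp_pow_isBigO`). Hence the
expansion holds for `T` to every order, and the same formula applied to `(t - x)^{2r}`, whose first
`r` coefficients vanish, bounds the central moments by `O(n^{-r})`. The remainder is then handled by
positivity: near `x` by the moment of order `2 q`, away from `x` by the bound
`e^{At} ≤ N⁻¹ e^{2At} + N ((t - x)/δ)^{4s}` with `s = q + 1` and `N = n^s`, in which the operator
applied to `e^{2At}` is bounded (`ExpGrowth.szaszOp_isLittleO`).

The coefficients are put into explicit form by Leibniz' rule, proved here for functions that admit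
the derivative at the point only (`AdmitsDeriv.mul`), followed by differentiation of the resulting
sum (`szaszCoeff_iteratedDeriv`).
-/

/-! ### Functions admitting a derivative at a point -/

theorem AdmitsDeriv.of_succ {N : ℕ} {f : ℝ → ℝ} {x : ℝ} (h : AdmitsDeriv (N + 1) f x) :
    AdmitsDeriv N f x :=
  h.1.self_of_nhds

theorem AdmitsDeriv.mono {M N : ℕ} (hMN : M ≤ N) {f : ℝ → ℝ} {x : ℝ} (h : AdmitsDeriv N f x) :
    AdmitsDeriv M f x := by
  induction hMN with
  | refl => exact h
  | step _ ih => exact ih h.of_succ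

theorem AdmitsDeriv.differentiableAt {N i : ℕ} (hi : i < N) {f : ℝ → ℝ} {x : ℝ}
    (h : AdmitsDeriv N f x) : DifferentiableAt ℝ (iteratedDeriv i f) x :=
  (h.mono (Nat.succ_le_of_lt hi)).2

theorem iteratedDeriv_iteratedDeriv (a b : ℕ) (f : ℝ → ℝ) :
    iteratedDeriv a (iteratedDeriv b f) = iteratedDeriv (a + b) f := by
  simp only [iteratedDeriv_eq_iterate, Function.iterate_add_apply]

theorem AdmitsDeriv.iterDeriv {a b : ℕ} {f : ℝ → ℝ} {x : ℝ} (h : AdmitsDeriv (a + b) f x) :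
    AdmitsDeriv a (iteratedDeriv b f) x := by
  induction a generalizing x with
  | zero => trivial
  | succ a ih =>
    rw [Nat.add_right_comm] at h
    refine ⟨?_, ?_⟩
    · filter_upwards [h.1] with y hy using ih hy
    · rw [iteratedDeriv_iteratedDeriv]
      exact h.2

theorem ContDiffAt.admitsDeriv {f : ℝ → ℝ} {x : ℝ} (h : ContDiffAt ℝ ⊤ f x) (N : ℕ) :
    AdmitsDeriv N f x := by
  have key : ∀ N : ℕ, ∀ y, ContDiffAt ℝ N f y → AdmitsDeriv N f y := by
    intro N
    induction N with
    | zero => intros; trivial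
    | succ N ih =>
      intro y hy
      refine ⟨?_, ?_⟩
      · filter_upwards [hy.eventually (by simp)] with z hz
        exact ih z (hz.of_le (by exact_mod_cast Nat.le_succ N))
      · have h1 := (hy.contDiffWithinAt (s := Set.univ)).differentiableWithinAt_iteratedDerivWithin
          (m := N) (by exact_mod_cast Nat.lt_succ_self N) (by simp)
        simpa [differentiableWithinAt_univ, iteratedDerivWithin_univ] using h1
  exact key N x (h.of_le le_top)

/-- Leibniz' rule under the pointwise differentiability hypothesis `AdmitsDeriv`, which is weaker
than `ContDiffAt` of the same order. -/
theorem AdmitsDeriv.mul {N : ℕ} {f g : ℝ → ℝ} {x : ℝ} (hf : AdmitsDeriv N f x)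
    (hg : AdmitsDeriv N g x) :
    AdmitsDeriv N (fun t => f t * g t) x ∧ iteratedDeriv N (fun t => f t * g t) x =
      ∑ p ∈ Finset.HasAntidiagonal.antidiagonal N, (N.choose p.1 : ℝ) *
        (iteratedDeriv p.1 f x * iteratedDeriv p.2 g x) := by
  induction N generalizing x with
  | zero => exact ⟨trivial, by simp⟩
  | succ N ih =>
    have hev : iteratedDeriv N (fun t => f t * g t) =ᶠ[𝓝 x] fun y =>
        ∑ p ∈ Finset.HasAntidiagonal.antidiagonal N, (N.choose p.1 : ℝ) *
          (iteratedDeriv p.1 f y * iteratedDeriv p.2 g y) := by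
      filter_upwards [hf.1, hg.1] with y hy hy' using (ih hy hy').2
    have hd : HasDerivAt (fun y => ∑ p ∈ Finset.HasAntidiagonal.antidiagonal N, (N.choose p.1 : ℝ) *
          (iteratedDeriv p.1 f y * iteratedDeriv p.2 g y))
        (∑ p ∈ Finset.HasAntidiagonal.antidiagonal N, (N.choose p.1 : ℝ) *
          (iteratedDeriv (p.1 + 1) f x * iteratedDeriv p.2 g x +
            iteratedDeriv p.1 f x * iteratedDeriv (p.2 + 1) g x)) x := by
      refine HasDerivAt.fun_sum fun p hp => HasDerivAt.const_mul _ ?_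
      have hp' := Finset.HasAntidiagonal.mem_antidiagonal.1 hp
      have h1 := (hf.differentiableAt (i := p.1) (by omega)).hasDerivAt
      have h2 := (hg.differentiableAt (i := p.2) (by omega)).hasDerivAt
      rw [iteratedDeriv_succ, iteratedDeriv_succ]
      exact h1.mul h2
    refine ⟨⟨?_, ?_⟩, ?_⟩
    · filter_upwards [hf.1, hg.1] with y hy hy' using (ih hy hy').1
    · exact hd.differentiableAt.congr_of_eventuallyEq hev
    · rw [iteratedDeriv_succ, hev.deriv_eq, hd.deriv,
        Finset.sum_antidiagonal_choose_succ_mul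
          (fun a b => iteratedDeriv a f x * iteratedDeriv b g x) N,
        ← Finset.sum_add_distrib]
      refine Finset.sum_congr rfl fun p hp => ?_
      have hp' := Finset.HasAntidiagonal.mem_antidiagonal.1 hp
      rw [Nat.choose_symm_of_eq_add hp'.symm]
      ring

/-- Taylor's formula with Peano's remainder: only the existence of the derivative of order `N` at
the point itself is needed. -/
theorem AdmitsDeriv.taylor_isLittleO {N : ℕ} {f : ℝ → ℝ} {x : ℝ} (hf : AdmitsDeriv N f x)
    (hc : ContinuousAt f x) (T : Polynomial ℝ)
    (hT : ∀ i ≤ N, (Polynomial.derivative^[i] T).eval x = iteratedDeriv i f x) :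
    (fun t => f t - T.eval t) =o[𝓝 x] fun t => (t - x) ^ N := by
  induction N generalizing f T with
  | zero =>
    have h0 := hT 0 le_rfl
    simp only [Function.iterate_zero, id, iteratedDeriv_zero] at h0
    simp only [pow_zero]
    rw [isLittleO_one_iff]
    have h1 := hc.sub T.continuous.continuousAt
    rw [ContinuousAt, Pi.sub_apply, h0, sub_self] at h1
    exact h1
  | succ N ih =>
    have h0 := hT 0 (Nat.zero_le _)
    simp only [Function.iterate_zero, id, iteratedDeriv_zero] at h0
    rcases Nat.eq_zero_or_pos N with rfl | hN
    · have h1 : DifferentiableAt ℝ f x := by simpa using hf.2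
      have h2 := (h1.hasDerivAt.sub (T.hasDerivAt x)).isLittleO
      have h3 := hT 1 le_rfl
      simp only [Function.iterate_one, iteratedDeriv_one] at h3
      simpa [h0, h3] using h2
    · have hev : ∀ᶠ y in 𝓝 x, DifferentiableAt ℝ f y := by
        filter_upwards [hf.1] with y hy
        simpa using hy.differentiableAt (i := 0) hN
      have hf' : AdmitsDeriv N (deriv f) x := by
        rw [← iteratedDeriv_one]
        exact AdmitsDeriv.iterDeriv hf
      have h1 := hf'.differentiableAt (i := 0) hN
      rw [iteratedDeriv_zero] at h1
      have h2 := ih hf' h1.continuousAt (Polynomial.derivative T) (fun i hi => by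
        rw [← Function.iterate_succ_apply, hT (i + 1) (by omega), iteratedDeriv_succ'])
      obtain ⟨δ, hδ, hball⟩ := Metric.eventually_nhds_iff_ball.1 hev
      have hmem : x ∈ Metric.ball x δ := Metric.mem_ball_self hδ
      have hn : 𝓝[Metric.ball x δ] x = 𝓝 x :=
        nhdsWithin_eq_nhds.2 (Metric.ball_mem_nhds x hδ)
      have h3 := (convex_ball x δ).isLittleO_pow_succ_real hmem (n := N)
        (f := fun t => f t - T.eval t)
        (f' := fun t => deriv f t - (Polynomial.derivative T).eval t)
        (fun t ht => ((hball t ht).hasDerivAt.sub (T.hasDerivAt t)).hasDerivWithinAt)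
        (by rwa [hn])
      rw [hn] at h3
      simpa [h0] using h3

/-! ### The coefficients of the expansion -/

theorem iteratedDeriv_zpow_eq_choose (a : ℤ) (i : ℕ) (y : ℝ) :
    iteratedDeriv i (fun t : ℝ => t ^ a) y =
      (i.factorial : ℝ) * ((Ring.choose a i : ℤ) : ℝ) * y ^ (a - i) := by
  rw [iteratedDeriv_eq_iterate, iter_deriv_zpow]
  congr 1
  have h := Ring.descPochhammer_eq_factorial_smul_choose a i
  rw [← Polynomial.eval_eq_smeval, descPochhammer_eval_eq_prod_range, nsmul_eq_mul] at h
  exact_mod_cast congrArg (Int.cast : ℤ → ℝ) h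

theorem admitsDeriv_zpow_mul {k : ℕ} (j : ℤ) {f : ℝ → ℝ} {y : ℝ} (hy : 0 < y) (p : ℕ)
    (hf : AdmitsDeriv (p + k) f y) :
    AdmitsDeriv p (fun t : ℝ => t ^ ((k : ℤ) - j) * iteratedDeriv k f t) y ∧
    iteratedDeriv p (fun t : ℝ => t ^ ((k : ℤ) - j) * iteratedDeriv k f t) y =
      ∑ i ∈ Finset.range (p + 1), (p.choose i : ℝ) *
        (((p - i).factorial : ℝ) * ((Ring.choose ((k : ℤ) - j) (p - i) : ℤ) : ℝ)
          * y ^ ((k : ℤ) - j - ((p - i : ℕ) : ℤ)) * iteratedDeriv (k + i) f y) := by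
  have h1 : AdmitsDeriv p (fun t : ℝ => t ^ ((k : ℤ) - j)) y :=
    ContDiffAt.admitsDeriv
      ((analyticAt_id.fun_zpow hy.ne').contDiffAt.of_le le_top) p
  obtain ⟨h2, h3⟩ := h1.mul hf.iterDeriv
  refine ⟨h2, h3.trans ?_⟩
  rw [Finset.Nat.sum_antidiagonal_eq_sum_range_succ_mk, ← Finset.sum_range_reflect]
  refine Finset.sum_congr rfl fun i hi => ?_
  have hi' := Finset.mem_range_succ_iff.1 hi
  have e1 : p + 1 - 1 - i = p - i := by omega
  have e2 : p - (p - i) = i := by omega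
  simp only [e1, e2]
  rw [iteratedDeriv_zpow_eq_choose, iteratedDeriv_iteratedDeriv, Nat.choose_symm hi', add_comm i k]

theorem szaszCoeff_of_pos (k : ℕ) (j : ℤ) (f : ℝ → ℝ) {y : ℝ} (hy : 0 < y) :
    szaszCoeff k j f y = 1 / (k.factorial : ℝ) *
        (y ^ j * iteratedDeriv k (fun t : ℝ => t ^ ((k : ℤ) - j) * iteratedDeriv k f t) y) := by
  unfold szaszCoeff szaszDiffOp
  split_ifs with h
  · subst h
    simp only [Nat.cast_zero, zero_sub, iteratedDeriv_zero]
    rw [← mul_assoc (y ^ j), ← zpow_add₀ hy.ne']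
    simp
  · rfl

theorem szaszCoeff_eq_explicit_zero {k : ℕ} (j : ℤ) {f : ℝ → ℝ} {y : ℝ} (hy : 0 < y)
    (hf : AdmitsDeriv (2 * k) f y) : szaszCoeff k j f y = szaszExplicitCoeff k 0 j f y := by
  rw [szaszCoeff_of_pos k j f hy, (admitsDeriv_zpow_mul j hy k (by rwa [← two_mul])).2,
    szaszExplicitCoeff, Finset.mul_sum, Finset.mul_sum]
  refine Finset.sum_congr rfl fun i hi => ?_
  have hi' := Finset.mem_range_succ_iff.1 hi
  have h1 : (k.factorial : ℝ) = k.choose i * i.factorial * (k - i).factorial := by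
    exact_mod_cast (Nat.choose_mul_factorial_mul_factorial hi').symm
  have h2 : y ^ i = y ^ j * y ^ ((k : ℤ) - j - ((k - i : ℕ) : ℤ)) := by
    rw [← zpow_add₀ hy.ne', ← zpow_natCast]
    congr 1
    omega
  have h3 : (k.choose i : ℝ) ≠ 0 := by exact_mod_cast (Nat.choose_pos hi').ne'
  have h4 : (i.factorial : ℝ) ≠ 0 := by positivity
  have h5 : ((k - i).factorial : ℝ) ≠ 0 := by positivity
  rw [h1, h2]
  simp only [Nat.cast_zero, add_zero]
  field_simp

/-- Pascal's rule summed against arbitrary weights. Both the derivative in `x` and the backward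
difference in `j` of the explicit coefficient have this shape. -/
theorem sum_choose_pascal (a : ℤ) (k : ℕ) (u : ℕ → ℝ) :
    ∑ i ∈ Finset.range (k + 1), ((Ring.choose (a + 1) (k - i) : ℤ) : ℝ) * u i =
      ∑ i ∈ Finset.range (k + 1), ((Ring.choose a (k - i) : ℤ) : ℝ) * u i +
        ∑ i ∈ Finset.range k, ((Ring.choose a (k - (i + 1)) : ℤ) : ℝ) * u i := by
  rw [Finset.sum_range_succ, Finset.sum_range_succ, add_right_comm, ← Finset.sum_add_distrib]
  congr 1
  · refine Finset.sum_congr rfl fun i hi => ?_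
    have hi' := Finset.mem_range.1 hi
    obtain ⟨d, hd⟩ : ∃ d, k - i = d + 1 := ⟨k - i - 1, by omega⟩
    rw [hd, show k - (i + 1) = d by omega, Ring.choose_succ_succ]
    push_cast
    ring
  · simp

theorem hasDerivAt_szaszExplicitCoeff {k m : ℕ} (j : ℤ) {f : ℝ → ℝ} {y : ℝ}
    (hf : AdmitsDeriv (2 * k + m + 1) f y) :
    HasDerivAt (szaszExplicitCoeff k m j f) (szaszExplicitCoeff k (m + 1) j f y) y := by
  have h1 : HasDerivAt (szaszExplicitCoeff k m j f)
      (∑ i ∈ Finset.range (k + 1),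
        (1 / (i.factorial : ℝ) * ((Ring.choose ((k : ℤ) + (m : ℤ) - j) (k - i) : ℤ) : ℝ) *
          (i * y ^ (i - 1)) * iteratedDeriv (k + m + i) f y +
        1 / (i.factorial : ℝ) * ((Ring.choose ((k : ℤ) + (m : ℤ) - j) (k - i) : ℤ) : ℝ) *
          y ^ i * iteratedDeriv (k + m + i + 1) f y)) y := by
    refine HasDerivAt.fun_sum fun i hi => ?_
    have hi' := Finset.mem_range_succ_iff.1 hi
    have h2 := (hf.differentiableAt (i := k + m + i) (by omega)).hasDerivAt
    rw [iteratedDeriv_succ]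
    exact ((hasDerivAt_pow i y).const_mul _).mul h2
  convert h1 using 1
  have h3 := sum_choose_pascal ((k : ℤ) + (m : ℤ) - j) k
    (fun i => 1 / (i.factorial : ℝ) * y ^ i * iteratedDeriv (k + m + i + 1) f y)
  rw [Finset.sum_add_distrib, Finset.sum_range_succ']
  simp only [Nat.cast_zero, zero_mul, mul_zero, add_zero]
  rw [szaszExplicitCoeff]
  conv_rhs => rw [add_comm]
  calc _ = _ := Finset.sum_congr rfl fun i _ => ?_
    _ = _ := h3
    _ = _ := ?_
  · rw [show (k : ℤ) + ((m + 1 : ℕ) : ℤ) - j = (k : ℤ) + m - j + 1 by push_cast; ring,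
      show k + (m + 1) + i = k + m + i + 1 by omega]
    ring
  · congr 1
    · exact Finset.sum_congr rfl fun i _ => by ring
    · refine Finset.sum_congr rfl fun i _ => ?_
      rw [Nat.factorial_succ, Nat.add_sub_cancel, ← add_assoc (k + m) i 1]
      push_cast
      have : (i.factorial : ℝ) ≠ 0 := by positivity
      field_simp

theorem szaszCoeff_iteratedDeriv {k : ℕ} (j : ℤ) {f : ℝ → ℝ} (m : ℕ) {y : ℝ} (hy : 0 < y)
    (hf : AdmitsDeriv (2 * k + m) f y) :
    AdmitsDeriv m (szaszCoeff k j f) y ∧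
      iteratedDeriv m (szaszCoeff k j f) y = szaszExplicitCoeff k m j f y := by
  induction m generalizing y with
  | zero => exact ⟨trivial, by rw [iteratedDeriv_zero]; exact szaszCoeff_eq_explicit_zero j hy hf⟩
  | succ m ih =>
    have hev : ∀ᶠ z in 𝓝 y, AdmitsDeriv m (szaszCoeff k j f) z ∧
        iteratedDeriv m (szaszCoeff k j f) z = szaszExplicitCoeff k m j f z := by
      filter_upwards [hf.1, lt_mem_nhds hy] with z hz hz' using ih hz' hz
    have heq : iteratedDeriv m (szaszCoeff k j f) =ᶠ[𝓝 y] szaszExplicitCoeff k m j f :=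
      hev.mono fun z hz => hz.2
    have hd := hasDerivAt_szaszExplicitCoeff j hf
    refine ⟨⟨hev.mono fun z hz => hz.1, hd.differentiableAt.congr_of_eventuallyEq heq⟩, ?_⟩
    rw [iteratedDeriv_succ, heq.deriv_eq, hd.deriv]

/-- The Pascal rule behind the induction on the order of differentiation: the backward difference
in `j` of the coefficient of order `k + 1` is the coefficient of order `k` for one more
derivative. -/
theorem szaszExplicitCoeff_sub (k m : ℕ) (j : ℤ) (f : ℝ → ℝ) (x : ℝ) :
    szaszExplicitCoeff (k + 1) m (j - 1) f x - szaszExplicitCoeff (k + 1) m j f x =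
      szaszExplicitCoeff k (m + 1) j f x := by
  have h := sum_choose_pascal (((k + 1 : ℕ) : ℤ) + m - j) (k + 1)
    (fun i => 1 / (i.factorial : ℝ) * x ^ i * iteratedDeriv (k + 1 + m + i) f x)
  have e : ((k + 1 : ℕ) : ℤ) + m - (j - 1) = ((k + 1 : ℕ) : ℤ) + m - j + 1 := by ring
  have e' : (k : ℤ) + ((m + 1 : ℕ) : ℤ) - j = ((k + 1 : ℕ) : ℤ) + m - j := by push_cast; ring
  simp only [szaszExplicitCoeff, e, e']
  rw [sub_eq_iff_eq_add']
  calc _ = _ := Finset.sum_congr rfl fun i _ => ?_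
    _ = _ := h
    _ = _ := ?_
  · ring
  · congr 1
    · exact Finset.sum_congr rfl fun i _ => by ring
    · refine Finset.sum_congr rfl fun i _ => ?_
      rw [Nat.add_sub_add_right, show k + (m + 1) + i = k + 1 + m + i by omega]
      ring

theorem szaszExplicitCoeff_order_zero (m : ℕ) (j : ℤ) (f : ℝ → ℝ) (x : ℝ) :
    szaszExplicitCoeff 0 m j f x = iteratedDeriv m f x := by
  simp [szaszExplicitCoeff]

/-! ### The Szász basis functions and their integrals -/

theorem szaszBasis_natCast (n k : ℕ) (x : ℝ) :
    szaszBasis n (k : ℤ) x = ((n : ℝ) * x) ^ k / (k.factorial : ℝ) * Real.exp (-((n : ℝ) * x)) := by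
  simp [szaszBasis]

theorem szaszBasis_of_neg (n : ℕ) {k : ℤ} (hk : k < 0) (x : ℝ) : szaszBasis n k x = 0 := by
  simp [szaszBasis, hk]

theorem szaszBasis_nonneg (n : ℕ) (k : ℤ) {x : ℝ} (hx : 0 ≤ x) : 0 ≤ szaszBasis n k x := by
  unfold szaszBasis
  split_ifs <;> positivity

theorem continuous_szaszBasis (n : ℕ) (k : ℤ) : Continuous (szaszBasis n k) := by
  unfold szaszBasis
  split_ifs <;> fun_prop

theorem integral_pow_mul_exp_neg {c : ℝ} (hc : 0 < c) (i : ℕ) :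
    ∫ t in Set.Ioi (0 : ℝ), t ^ i * Real.exp (-(c * t)) = (i.factorial : ℝ) / c ^ (i + 1) := by
  have h := Real.integral_rpow_mul_exp_neg_mul_Ioi (a := (i : ℝ) + 1) (by positivity) hc
  rw [Real.Gamma_nat_eq_factorial] at h
  simp only [add_sub_cancel_right, Real.rpow_natCast] at h
  rw [h, show ((i : ℝ) + 1) = ((i + 1 : ℕ) : ℝ) by push_cast; ring, Real.rpow_natCast, one_div,
    inv_pow, inv_mul_eq_div]

theorem integrableOn_pow_mul_exp_neg {c : ℝ} (hc : 0 < c) (i : ℕ) :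
    IntegrableOn (fun t : ℝ => t ^ i * Real.exp (-(c * t))) (Set.Ioi 0) := by
  -- a non-integrable function would have integral `0`
  by_contra h
  have h1 := integral_undef h
  rw [integral_pow_mul_exp_neg hc] at h1
  have : (i.factorial : ℝ) / c ^ (i + 1) ≠ 0 := by positivity
  exact this h1

theorem szaszBasis_mul_exp (n i : ℕ) (A t : ℝ) :
    szaszBasis n (i : ℤ) t * Real.exp (A * t) =
      (n : ℝ) ^ i / (i.factorial : ℝ) * (t ^ i * Real.exp (-(((n : ℝ) - A) * t))) := by
  rw [szaszBasis_natCast, mul_assoc, ← Real.exp_add, mul_pow]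
  rw [show -((n : ℝ) * t) + A * t = -(((n : ℝ) - A) * t) by ring]
  ring

theorem integrableOn_szaszBasis_mul_exp {n : ℕ} {A : ℝ} (hn : A < n) (i : ℕ) :
    IntegrableOn (fun t => szaszBasis n (i : ℤ) t * Real.exp (A * t)) (Set.Ioi 0) := by
  simp only [szaszBasis_mul_exp]
  exact (integrableOn_pow_mul_exp_neg (sub_pos.2 hn) i).const_mul _

theorem integral_szaszBasis_mul_exp {n : ℕ} {A : ℝ} (hn : A < n) (i : ℕ) :
    (n : ℝ) * ∫ t in Set.Ioi (0 : ℝ), szaszBasis n (i : ℤ) t * Real.exp (A * t) =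
      ((n : ℝ) / (n - A)) ^ (i + 1) := by
  simp only [szaszBasis_mul_exp]
  rw [integral_const_mul, integral_pow_mul_exp_neg (sub_pos.2 hn), div_pow]
  have : (i.factorial : ℝ) ≠ 0 := by positivity
  field_simp
  ring

theorem integral_szaszBasis_mul_pow {n : ℕ} (hn : 0 < n) (i l : ℕ) :
    (n : ℝ) * ∫ t in Set.Ioi (0 : ℝ), szaszBasis n (i : ℤ) t * t ^ l =
      ((i + l).factorial : ℝ) / ((i.factorial : ℝ) * (n : ℝ) ^ l) := by
  have hn' : (0 : ℝ) < n := by exact_mod_cast hn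
  have h : ∀ t : ℝ, szaszBasis n (i : ℤ) t * t ^ l =
      (n : ℝ) ^ i / (i.factorial : ℝ) * (t ^ (i + l) * Real.exp (-((n : ℝ) * t))) := by
    intro t
    rw [szaszBasis_natCast, mul_pow]
    ring
  simp only [h]
  rw [integral_const_mul, integral_pow_mul_exp_neg hn']
  have : (i.factorial : ℝ) ≠ 0 := by positivity
  field_simp
  ring

theorem hasSum_szaszBasis_mul_pow (n : ℕ) (y r : ℝ) :
    HasSum (fun k : ℕ => szaszBasis n (k : ℤ) y * r ^ k)
      (Real.exp (n * y * r) * Real.exp (-((n : ℝ) * y))) := by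
  have h := (NormedSpace.expSeries_div_hasSum_exp ((n : ℝ) * y * r)).mul_right
    (Real.exp (-((n : ℝ) * y)))
  rw [← Real.exp_eq_exp_ℝ] at h
  refine h.congr_fun ?_
  intro k
  rw [szaszBasis_natCast, mul_pow _ r]
  ring

/-! ### Functions of exponential growth -/

theorem ExpGrowth.mono {A B : ℝ} (hAB : A ≤ B) {f : ℝ → ℝ} (hf : ExpGrowth A f) :
    ExpGrowth B f := by
  obtain ⟨h1, K, hK, h2⟩ := hf
  refine ⟨h1, K, hK, fun t ht => (h2 t ht).trans ?_⟩
  gcongr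

theorem ExpGrowth.add {A : ℝ} {f g : ℝ → ℝ} (hf : ExpGrowth A f) (hg : ExpGrowth A g) :
    ExpGrowth A (fun t => f t + g t) := by
  obtain ⟨h1, K, hK, h2⟩ := hf
  obtain ⟨h1', K', hK', h2'⟩ := hg
  refine ⟨h1.add h1', K + K', by positivity, fun t ht => (abs_add_le _ _).trans ?_⟩
  rw [add_mul]
  exact add_le_add (h2 t ht) (h2' t ht)

theorem ExpGrowth.const_mul {A : ℝ} {f : ℝ → ℝ} (hf : ExpGrowth A f) (c : ℝ) :
    ExpGrowth A (fun t => c * f t) := by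
  obtain ⟨h1, K, hK, h2⟩ := hf
  refine ⟨h1.smul c, (|c| + 1) * K, by positivity, fun t ht => ?_⟩
  rw [abs_mul, mul_assoc]
  have := h2 t ht
  gcongr
  linarith

theorem expGrowth_exp (A : ℝ) : ExpGrowth A (fun t => Real.exp (A * t)) :=
  ⟨(by fun_prop : Continuous fun t : ℝ => Real.exp (A * t)).locallyIntegrable.locallyIntegrableOn _,
    1, one_pos, fun t _ => by rw [abs_of_pos (Real.exp_pos _), one_mul]⟩

theorem expGrowth_polynomial (P : Polynomial ℝ) : ExpGrowth 1 (fun t => P.eval t) := by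
  induction P using Polynomial.induction_on' with
  | add P Q hP hQ =>
    simp only [Polynomial.eval_add]
    exact hP.add hQ
  | monomial l a =>
    simp only [Polynomial.eval_monomial]
    refine ExpGrowth.const_mul (f := fun t => t ^ l) ⟨?_, (l.factorial : ℝ), by positivity, ?_⟩ a
    · exact (continuous_pow l).locallyIntegrable.locallyIntegrableOn _
    · intro t ht
      have h := Real.pow_div_factorial_le_exp t ht l
      rw [div_le_iff₀ (by positivity)] at h
      rw [abs_of_nonneg (by positivity), one_mul, mul_comm]
      exact h

theorem ExpGrowth.integrableOn {A : ℝ} {f : ℝ → ℝ} (hf : ExpGrowth A f) {n : ℕ} (hn : A < n)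
    (i : ℤ) : IntegrableOn (fun t => szaszBasis n i t * f t) (Set.Ioi 0) := by
  rcases lt_or_ge i 0 with hi | hi
  · simp [szaszBasis_of_neg n hi]
  obtain ⟨i, rfl⟩ := Int.eq_ofNat_of_zero_le hi
  obtain ⟨h1, K, hK, h2⟩ := hf
  refine Integrable.mono' ((integrableOn_szaszBasis_mul_exp hn i).const_mul K) ?_ ?_
  · exact (continuous_szaszBasis n i).aestronglyMeasurable.mul
      (h1.aestronglyMeasurable.mono_set Set.Ioi_subset_Ici_self)
  · filter_upwards [ae_restrict_mem measurableSet_Ioi] with t ht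
    have h3 := szaszBasis_nonneg n i (le_of_lt ht)
    rw [norm_mul, Real.norm_of_nonneg h3, Real.norm_eq_abs, mul_left_comm]
    exact mul_le_mul_of_nonneg_left (h2 t (le_of_lt ht)) h3

/-! ### The operators as exponential generating functions -/

/-- The coefficient with which `f` enters the operator `S_{n,j}`: the sum defining `S_{n,j} f` is
`∑_k s_{n,k}(x) β(k - j)`, where `β i = n ∫ s_{n,i} f` for `i ≥ 0` and `β i = f 0` for `i < 0`. -/
noncomputable def szaszFunctional (n : ℕ) (f : ℝ → ℝ) (i : ℤ) : ℝ :=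
  if i < 0 then f 0 else (n : ℝ) * ∫ t in Set.Ioi (0 : ℝ), szaszBasis n i t * f t

theorem abs_szaszFunctional_le {A : ℝ} {f g : ℝ → ℝ} (hg : ExpGrowth A g) {n : ℕ} (hn : A < n)
    (hfg : ∀ t, 0 ≤ t → |f t| ≤ g t) (i : ℤ) :
    |szaszFunctional n f i| ≤ szaszFunctional n g i := by
  unfold szaszFunctional
  split_ifs with hi
  · exact hfg 0 le_rfl
  · rw [abs_mul, Nat.abs_cast]
    refine mul_le_mul_of_nonneg_left ?_ (Nat.cast_nonneg n)
    rw [← Real.norm_eq_abs]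
    refine norm_integral_le_of_norm_le (hg.integrableOn hn i) ?_
    filter_upwards [ae_restrict_mem measurableSet_Ioi] with t ht
    have h3 := szaszBasis_nonneg n i (le_of_lt ht)
    rw [norm_mul, Real.norm_of_nonneg h3]
    exact mul_le_mul_of_nonneg_left (hfg t (le_of_lt ht)) h3

theorem szaszFunctional_exp_le {A : ℝ} (hA : 0 ≤ A) {n : ℕ} (hn : A < n) (j : ℤ) (k : ℕ) :
    szaszFunctional n (fun t => Real.exp (A * t)) (k - j) ≤
      ((n : ℝ) / (n - A)) ^ (j.natAbs + 1) * ((n : ℝ) / (n - A)) ^ k := by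
  have h1 : 1 ≤ (n : ℝ) / (n - A) := by
    rw [le_div_iff₀ (sub_pos.2 hn)]
    linarith
  rw [← pow_add]
  rcases lt_or_ge ((k : ℤ) - j) 0 with hi | hi
  · simp only [szaszFunctional, hi, if_true, mul_zero, Real.exp_zero]
    exact one_le_pow₀ h1
  · obtain ⟨i, hi'⟩ := Int.eq_ofNat_of_zero_le hi
    rw [hi', szaszFunctional, if_neg (by omega), integral_szaszBasis_mul_exp hn]
    exact pow_le_pow_right₀ h1 (by omega)

theorem szaszFunctional_const_mul (n : ℕ) (f : ℝ → ℝ) (c : ℝ) (i : ℤ) :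
    szaszFunctional n (fun t => c * f t) i = c * szaszFunctional n f i := by
  unfold szaszFunctional
  split_ifs
  · rfl
  · simp only [mul_left_comm _ c]
    rw [integral_const_mul]
    ring

theorem szaszFunctional_add {A : ℝ} {f g : ℝ → ℝ} (hf : ExpGrowth A f) (hg : ExpGrowth A g)
    {n : ℕ} (hn : A < n) (i : ℤ) :
    szaszFunctional n (fun t => f t + g t) i = szaszFunctional n f i + szaszFunctional n g i := by
  unfold szaszFunctional
  split_ifs
  · rfl
  · simp only [mul_add]
    rw [integral_add (hf.integrableOn hn i) (hg.integrableOn hn i), mul_add]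

theorem ExpGrowth.abs_szaszFunctional_le {A : ℝ} (hA : 0 ≤ A) {f : ℝ → ℝ} {K : ℝ}
    (hf : ∀ t, 0 ≤ t → |f t| ≤ K * Real.exp (A * t)) (hK : 0 ≤ K) {n : ℕ} (hn : A < n)
    (j : ℤ) (k : ℕ) :
    |szaszFunctional n f (k - j)| ≤
      K * ((n : ℝ) / (n - A)) ^ (j.natAbs + 1) * ((n : ℝ) / (n - A)) ^ k := by
  refine (_root_.abs_szaszFunctional_le ((expGrowth_exp A).const_mul K) hn hf _).trans ?_
  rw [szaszFunctional_const_mul, mul_assoc]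
  exact mul_le_mul_of_nonneg_left (szaszFunctional_exp_le hA hn j k) hK

theorem summable_szaszBasis_mul {n : ℕ} {b : ℕ → ℝ} {C r : ℝ} (hb : ∀ k, |b k| ≤ C * r ^ k)
    (y : ℝ) : Summable (fun k : ℕ => szaszBasis n (k : ℤ) y * b k) := by
  refine Summable.of_norm_bounded
    (g := fun k : ℕ => Real.exp (-((n : ℝ) * y)) * C * ((|(n : ℝ) * y| * r) ^ k / k.factorial))
    ((Real.summable_pow_div_factorial _).mul_left _) fun k => ?_
  rw [szaszBasis_natCast, norm_mul, norm_mul, norm_div, norm_pow, Real.norm_eq_abs,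
    Real.norm_eq_abs (b k), Real.norm_of_nonneg (Real.exp_pos _).le, RCLike.norm_natCast, mul_pow]
  calc _ ≤ |(n : ℝ) * y| ^ k / (k.factorial : ℝ) * Real.exp (-((n : ℝ) * y)) * (C * r ^ k) := by
        gcongr
        exact hb k
    _ = _ := by ring

theorem ExpGrowth.summable {A : ℝ} (hA : 0 ≤ A) {f : ℝ → ℝ} (hf : ExpGrowth A f) {n : ℕ}
    (hn : A < n) (j : ℤ) (y : ℝ) :
    Summable (fun k : ℕ => szaszBasis n (k : ℤ) y * szaszFunctional n f (k - j)) := by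
  obtain ⟨-, K, hK, h2⟩ := hf
  exact summable_szaszBasis_mul (ExpGrowth.abs_szaszFunctional_le hA h2 hK.le hn j) y

theorem szaszTerm_eq (n : ℕ) (j : ℤ) (f : ℝ → ℝ) (x : ℝ) (i : ℕ) :
    szaszTerm n j f x (j + i) = szaszBasis n (j + i) x * szaszFunctional n f i := by
  unfold szaszTerm szaszFunctional
  rw [if_neg (by omega), add_sub_cancel_left]

/-- For `j ≥ 0` the series of `S_{n,j} f` is the tail of the series `∑_k s_{n,k}(x) β(k - j)`; for
`j < 0` it is that series preceded by zero terms. -/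
theorem ExpGrowth.summable_szaszTerm_and_eq {A : ℝ} (hA : 0 ≤ A) {f : ℝ → ℝ} (hf : ExpGrowth A f)
    {n : ℕ} (hn : A < n) (j : ℤ) (y : ℝ) :
    Summable (fun i : ℕ => szaszTerm n j f y (j + i)) ∧
      szaszOp n j f y = ∑' k : ℕ, szaszBasis n (k : ℤ) y * szaszFunctional n f (k - j) := by
  have hs := hf.summable hA hn j y
  unfold szaszOp
  rcases le_or_gt 0 j with hj | hj
  · obtain ⟨J, rfl⟩ := Int.eq_ofNat_of_zero_le hj
    have h1 : ∀ i : ℕ, szaszTerm n J f y (J + i) =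
        szaszBasis n ((i + J : ℕ) : ℤ) y * szaszFunctional n f ((i + J : ℕ) - (J : ℤ)) := by
      intro i
      rw [szaszTerm_eq]
      push_cast
      rw [add_comm (J : ℤ), add_sub_cancel_right]
    simp only [h1, Int.toNat_natCast]
    refine ⟨(summable_nat_add_iff (f := fun k : ℕ =>
      szaszBasis n (k : ℤ) y * szaszFunctional n f (k - (J : ℤ))) J).2 hs, ?_⟩
    rw [← hs.sum_add_tsum_nat_add J, Finset.mul_sum]
    congr 1
    refine Finset.sum_congr rfl fun k hk => ?_
    have hk' := Finset.mem_range.1 hk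
    rw [szaszFunctional, if_pos (by omega), mul_comm]
  · obtain ⟨J, hJ⟩ := Int.eq_ofNat_of_zero_le (neg_nonneg.2 hj.le)
    obtain rfl : j = -(J : ℤ) := by omega
    have h1 : ∀ k : ℕ, szaszBasis n (k : ℤ) y * szaszFunctional n f (k - -(J : ℤ)) =
        szaszTerm n (-(J : ℤ)) f y (-(J : ℤ) + ((k + J : ℕ) : ℤ)) := by
      intro k
      rw [szaszTerm_eq]
      push_cast
      rw [sub_neg_eq_add, neg_add_cancel_comm_assoc]
    simp only [h1] at hs ⊢
    have hs' := (summable_nat_add_iff (f := fun i : ℕ => szaszTerm n (-(J : ℤ)) f y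
      (-(J : ℤ) + (i : ℤ))) J).1 hs
    refine ⟨hs', ?_⟩
    rw [← hs'.sum_add_tsum_nat_add J, Int.toNat_of_nonpos (by omega), Finset.range_zero,
      Finset.sum_empty, mul_zero, zero_add, Finset.sum_eq_zero, zero_add]
    intro i hi
    have hi' := Finset.mem_range.1 hi
    rw [szaszTerm_eq, szaszBasis_of_neg n (by omega), zero_mul]

theorem ExpGrowth.szaszOp_eq {A : ℝ} (hA : 0 ≤ A) {f : ℝ → ℝ} (hf : ExpGrowth A f)
    {n : ℕ} (hn : A < n) (j : ℤ) (y : ℝ) :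
    szaszOp n j f y = ∑' k : ℕ, szaszBasis n (k : ℤ) y * szaszFunctional n f (k - j) :=
  (hf.summable_szaszTerm_and_eq hA hn j y).2

theorem ExpGrowth.szaszOpDefined {A : ℝ} (hA : 0 ≤ A) {f : ℝ → ℝ} (hf : ExpGrowth A f)
    {n : ℕ} (hn : A < n) (j : ℤ) : SzaszOpDefined n j f :=
  ⟨fun k _ => hf.integrableOn hn (k - j), fun x _ => (hf.summable_szaszTerm_and_eq hA hn j x).1⟩

theorem szaszOp_const_mul (n : ℕ) (j : ℤ) {A : ℝ} (hA : 0 ≤ A) {f : ℝ → ℝ} (hf : ExpGrowth A f)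
    (hn : A < n) (c y : ℝ) : szaszOp n j (fun t => c * f t) y = c * szaszOp n j f y := by
  rw [hf.szaszOp_eq hA hn, (hf.const_mul c).szaszOp_eq hA hn, ← tsum_mul_left]
  simp only [szaszFunctional_const_mul, mul_left_comm]

theorem szaszOp_add (n : ℕ) (j : ℤ) {A : ℝ} (hA : 0 ≤ A) {f g : ℝ → ℝ} (hf : ExpGrowth A f)
    (hg : ExpGrowth A g) (hn : A < n) (y : ℝ) :
    szaszOp n j (fun t => f t + g t) y = szaszOp n j f y + szaszOp n j g y := by
  rw [hf.szaszOp_eq hA hn, hg.szaszOp_eq hA hn, (hf.add hg).szaszOp_eq hA hn,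
    ← (hf.summable hA hn j y).tsum_add (hg.summable hA hn j y)]
  simp only [szaszFunctional_add hf hg hn, mul_add]

theorem abs_szaszOp_le (n : ℕ) (j : ℤ) {A : ℝ} (hA : 0 ≤ A) {f g : ℝ → ℝ} (hf : ExpGrowth A f)
    (hg : ExpGrowth A g) (hn : A < n) {y : ℝ} (hy : 0 ≤ y) (hfg : ∀ t, 0 ≤ t → |f t| ≤ g t) :
    |szaszOp n j f y| ≤ szaszOp n j g y := by
  rw [hf.szaszOp_eq hA hn, hg.szaszOp_eq hA hn, ← Real.norm_eq_abs]
  refine tsum_of_norm_bounded (hg.summable hA hn j y).hasSum fun k => ?_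
  have h3 := szaszBasis_nonneg n k hy
  rw [norm_mul, Real.norm_of_nonneg h3]
  exact mul_le_mul_of_nonneg_left (abs_szaszFunctional_le hg hn hfg _) h3

theorem ExpGrowth.szaszOp_isBigO_one (j : ℤ) {A : ℝ} (hA : 0 ≤ A) {f : ℝ → ℝ}
    (hf : ExpGrowth A f) {y : ℝ} (hy : 0 ≤ y) :
    (fun n : ℕ => szaszOp n j f y) =O[atTop] fun _ => (1 : ℝ) := by
  obtain ⟨K, hK, h2⟩ := hf.2
  refine IsBigO.of_bound (K * 2 ^ (j.natAbs + 1) * Real.exp (2 * A * y)) ?_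
  have hlim : ∀ᶠ n : ℕ in atTop, 2 * A + 1 ≤ (n : ℝ) :=
    tendsto_natCast_atTop_atTop.eventually_ge_atTop _
  filter_upwards [hlim] with n hn2
  have hn : A < n := by linarith
  have hpos : 0 < (n : ℝ) - A := sub_pos.2 hn
  rw [hf.szaszOp_eq hA hn, norm_one, mul_one]
  have hr : (n : ℝ) / (n - A) ≤ 2 := by
    rw [div_le_iff₀ hpos]
    linarith
  have hr0 : 0 ≤ (n : ℝ) / (n - A) := by positivity
  have hexp : (n : ℝ) * y * (n / (n - A)) + -((n : ℝ) * y) ≤ 2 * A * y := by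
    have : (n : ℝ) * y * (n / (n - A)) + -((n : ℝ) * y) = (n / (n - A)) * A * y := by
      field_simp
      ring
    rw [this]
    gcongr
  refine (tsum_of_norm_bounded ((hasSum_szaszBasis_mul_pow n y (n / (n - A))).mul_left
    (K * ((n : ℝ) / (n - A)) ^ (j.natAbs + 1))) fun k => ?_).trans ?_
  · have h3 := szaszBasis_nonneg n k hy
    rw [norm_mul, Real.norm_of_nonneg h3, mul_left_comm]
    exact mul_le_mul_of_nonneg_left (ExpGrowth.abs_szaszFunctional_le hA h2 hK.le hn j k) h3
  · rw [← Real.exp_add]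
    gcongr

/-! ### Derivatives of the operators -/

theorem hasDerivAt_tsum_div_factorial {b : ℕ → ℝ} {C r : ℝ}
    (hb : ∀ k, |b k| ≤ C * r ^ k) (z : ℝ) :
    HasDerivAt (fun z : ℝ => ∑' k : ℕ, z ^ k / (k.factorial : ℝ) * b k)
      (∑' k : ℕ, z ^ k / (k.factorial : ℝ) * b (k + 1)) z := by
  set R : ℝ := |z| + 1 with hR
  have hR0 : 0 < R := by positivity
  set g' : ℕ → ℝ → ℝ := fun k w => (k : ℝ) * w ^ (k - 1) / (k.factorial : ℝ) * b k with hg'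
  have hg'_succ : ∀ k w, g' (k + 1) w = w ^ k / (k.factorial : ℝ) * b (k + 1) := by
    intro k w
    have : (k.factorial : ℝ) ≠ 0 := by positivity
    simp only [hg', Nat.add_sub_cancel, Nat.factorial_succ]
    push_cast
    field_simp
  set u : ℕ → ℝ := fun k => (k : ℝ) * R ^ (k - 1) / (k.factorial : ℝ) * (C * r ^ k) with hu
  have hu_sum : Summable u := by
    rw [← summable_nat_add_iff 1]
    refine ((Real.summable_pow_div_factorial (R * r)).mul_left (C * r)).congr fun k => ?_
    have : (k.factorial : ℝ) ≠ 0 := by positivity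
    simp only [hu, Nat.add_sub_cancel, Nat.factorial_succ]
    push_cast
    field_simp
    ring_nf
  have hbound : ∀ k w, w ∈ Metric.ball (0 : ℝ) R → ‖g' k w‖ ≤ u k := by
    intro k w hw
    have hw' : |w| ≤ R := by
      rw [mem_ball_zero_iff, Real.norm_eq_abs] at hw
      exact hw.le
    simp only [hg', hu]
    rw [norm_mul, norm_div, norm_mul, norm_pow, RCLike.norm_natCast, RCLike.norm_natCast,
      Real.norm_eq_abs, Real.norm_eq_abs]
    gcongr
    exact hb k
  have hz : z ∈ Metric.ball (0 : ℝ) R := by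
    rw [mem_ball_zero_iff, Real.norm_eq_abs, hR]
    linarith
  have h := hasDerivAt_tsum_of_isPreconnected (g := fun (k : ℕ) (w : ℝ) =>
      w ^ k / (k.factorial : ℝ) * b k) (g' := g') (y₀ := 0) hu_sum Metric.isOpen_ball
    (convex_ball (0 : ℝ) R).isPreconnected
    (fun k w _ => ((hasDerivAt_pow k w).div_const _).mul_const _) hbound
    (Metric.mem_ball_self hR0) ?_ hz
  · have hs : Summable fun k => g' k z := Summable.of_norm_bounded hu_sum fun k => hbound k z hz
    rw [hs.tsum_eq_zero_add] at h
    simp only [hg'_succ] at h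
    simpa [hg'] using h
  · refine summable_of_ne_finset_zero (s := {0}) fun k hk => ?_
    simp [show k ≠ 0 by simpa using hk]

/-- Differentiation lowers the parameter `j`, because `s_{n,k}' = n (s_{n,k-1} - s_{n,k})`. -/
theorem ExpGrowth.hasDerivAt_szaszOp {A : ℝ} (hA : 0 ≤ A) {f : ℝ → ℝ} (hf : ExpGrowth A f)
    {n : ℕ} (hn : A < n) (j : ℤ) (y : ℝ) :
    HasDerivAt (szaszOp n j f) ((n : ℝ) * (szaszOp n (j - 1) f y - szaszOp n j f y)) y := by
  have hG : ∀ (j : ℤ) (y : ℝ), szaszOp n j f y = (∑' k : ℕ, ((n : ℝ) * y) ^ k / (k.factorial : ℝ) *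
      szaszFunctional n f (k - j)) * Real.exp (-((n : ℝ) * y)) := by
    intro j y
    rw [hf.szaszOp_eq hA hn, ← tsum_mul_right]
    refine tsum_congr fun k => ?_
    rw [szaszBasis_natCast]
    ring
  obtain ⟨K, hK, h2⟩ := hf.2
  have hpos : 0 < (n : ℝ) - A := sub_pos.2 hn
  have h1 := hasDerivAt_tsum_div_factorial
    (ExpGrowth.abs_szaszFunctional_le hA h2 hK.le hn j) ((n : ℝ) * y)
  have h3 : HasDerivAt (fun y : ℝ => (n : ℝ) * y) n y := by
    simpa using (hasDerivAt_id y).const_mul (n : ℝ)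
  have h4 := (h1.comp y h3).mul h3.neg.exp
  rw [show szaszOp n j f = _ from funext (hG j), hG (j - 1) y]
  refine h4.congr_deriv ?_
  have e : ∀ k : ℕ, ((k + 1 : ℕ) : ℤ) - j = k - (j - 1) := fun k => by push_cast; ring
  simp only [e, Function.comp, Pi.neg_apply]
  ring

theorem ExpGrowth.iteratedDeriv_szaszOp {A : ℝ} (hA : 0 ≤ A) {f : ℝ → ℝ} (hf : ExpGrowth A f)
    {n : ℕ} (hn : A < n) (m : ℕ) (j : ℤ) :
    Differentiable ℝ (iteratedDeriv m (szaszOp n j f)) ∧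
      ∀ y, iteratedDeriv (m + 1) (szaszOp n j f) y = (n : ℝ) *
        (iteratedDeriv m (szaszOp n (j - 1) f) y - iteratedDeriv m (szaszOp n j f) y) := by
  induction m generalizing j with
  | zero =>
    have h := hf.hasDerivAt_szaszOp hA hn j
    simp only [zero_add, iteratedDeriv_zero, iteratedDeriv_one]
    exact ⟨fun y => (h y).differentiableAt, fun y => (h y).deriv⟩
  | succ m ih =>
    have h1 := funext (ih j).2
    have hd : ∀ y, HasDerivAt (iteratedDeriv (m + 1) (szaszOp n j f)) ((n : ℝ) *
        (iteratedDeriv (m + 1) (szaszOp n (j - 1) f) y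
          - iteratedDeriv (m + 1) (szaszOp n j f) y)) y := by
      intro y
      conv => arg 1; rw [h1]
      rw [iteratedDeriv_succ, iteratedDeriv_succ]
      exact (((ih (j - 1)).1 y).hasDerivAt.sub ((ih j).1 y).hasDerivAt).const_mul _
    refine ⟨fun y => (hd y).differentiableAt, fun y => ?_⟩
    rw [iteratedDeriv_succ, (hd y).deriv]

theorem ExpGrowth.admitsDeriv_szaszOp {A : ℝ} (hA : 0 ≤ A) {f : ℝ → ℝ} (hf : ExpGrowth A f)
    {n : ℕ} (hn : A < n) (m : ℕ) (j : ℤ) (y : ℝ) : AdmitsDeriv m (szaszOp n j f) y := by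
  induction m generalizing y with
  | zero => trivial
  | succ m ih => exact ⟨Eventually.of_forall ih, (hf.iteratedDeriv_szaszOp hA hn m j).1 y⟩

/-! ### Moments -/

theorem isBigO_inv_pow_of_le {a b : ℕ} (h : a ≤ b) :
    (fun n : ℕ => 1 / (n : ℝ) ^ b) =O[atTop] fun n : ℕ => 1 / (n : ℝ) ^ a := by
  refine IsBigO.of_bound 1 ?_
  filter_upwards [eventually_gt_atTop 0] with n hn
  have hn' : (1 : ℝ) ≤ n := by exact_mod_cast hn
  rw [one_mul, Real.norm_of_nonneg (by positivity), Real.norm_of_nonneg (by positivity)]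
  gcongr

theorem szaszBasis_isBigO_inv_pow (k Q : ℕ) {x : ℝ} (hx : 0 < x) :
    (fun n : ℕ => szaszBasis n (k : ℤ) x) =O[atTop] fun n : ℕ => 1 / (n : ℝ) ^ Q := by
  have h1 : Tendsto (fun n : ℕ => (n : ℝ) * x) atTop atTop :=
    tendsto_natCast_atTop_atTop.atTop_mul_const hx
  have h2 := ((Real.tendsto_pow_mul_exp_neg_atTop_nhds_zero (k + Q)).comp h1).isBigO_one ℝ
  have h3 := (h2.const_mul_left (1 / ((k.factorial : ℝ) * x ^ Q))).mul
    (isBigO_refl (fun n : ℕ => 1 / (n : ℝ) ^ Q) atTop)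
  refine h3.congr' ?_ (by simp)
  filter_upwards [eventually_gt_atTop 0] with n hn
  have hn' : (n : ℝ) ≠ 0 := by exact_mod_cast hn.ne'
  have : (k.factorial : ℝ) ≠ 0 := by positivity
  simp only [Function.comp, szaszBasis_natCast]
  field_simp
  ring

theorem hasSum_szaszBasis_mul_choose (n r : ℕ) (x : ℝ) :
    HasSum (fun k : ℕ => szaszBasis n (k : ℤ) x * (k.choose r : ℝ))
      (((n : ℝ) * x) ^ r / (r.factorial : ℝ)) := by
  have h1 := (hasSum_szaszBasis_mul_pow n x 1).mul_left (((n : ℝ) * x) ^ r / (r.factorial : ℝ))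
  rw [← Real.exp_add, mul_one, add_neg_cancel, Real.exp_zero, mul_one] at h1
  have h2 : ∑ k ∈ Finset.range r, szaszBasis n (k : ℤ) x * (k.choose r : ℝ) = 0 :=
    Finset.sum_eq_zero fun k hk => by
      rw [Nat.choose_eq_zero_of_lt (Finset.mem_range.1 hk), Nat.cast_zero, mul_zero]
  rw [← hasSum_nat_add_iff' r, h2, sub_zero]
  refine h1.congr_fun fun k => ?_
  have h3 : ((k + r).choose r : ℝ) * (k.factorial * r.factorial) = (k + r).factorial := by
    rw [← Nat.add_choose_mul_factorial_mul_factorial k r]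
    push_cast
    ring
  have h4 : (k.factorial : ℝ) ≠ 0 := by positivity
  have h5 : (r.factorial : ℝ) ≠ 0 := by positivity
  have h6 : ((k + r).factorial : ℝ) ≠ 0 := by positivity
  rw [szaszBasis_natCast, szaszBasis_natCast, one_pow, mul_one, eq_div_of_mul_eq (by positivity) h3]
  field_simp
  ring

theorem szaszFunctional_pow {n : ℕ} (hn : 0 < n) (l : ℕ) {i : ℤ} (hi : 0 ≤ i) :
    szaszFunctional n (fun t => t ^ l) i =
      (l.factorial : ℝ) * ((Ring.choose (i + l) l : ℤ) : ℝ) / (n : ℝ) ^ l := by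
  obtain ⟨i, rfl⟩ := Int.eq_ofNat_of_zero_le hi
  have hn' : (n : ℝ) ≠ 0 := by exact_mod_cast hn.ne'
  rw [szaszFunctional, if_neg (by omega), integral_szaszBasis_mul_pow hn,
    show (i : ℤ) + l = ((i + l : ℕ) : ℤ) by push_cast; rfl, Ring.choose_natCast,
    ← Nat.add_choose_mul_factorial_mul_factorial i l]
  have h4 : (i.factorial : ℝ) ≠ 0 := by positivity
  push_cast
  field_simp

/-- The moments with `β i` replaced, for all integers `i`, by the polynomial in `i` that it equals
for `i ≥ 0`; Vandermonde's identity reduces them to factorial moments. -/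
theorem hasSum_szaszBasis_mul_ringChoose {n : ℕ} (hn : 0 < n) (j : ℤ) (l : ℕ) (x : ℝ) :
    HasSum (fun k : ℕ => szaszBasis n (k : ℤ) x *
        ((l.factorial : ℝ) * ((Ring.choose ((k : ℤ) - j + l) l : ℤ) : ℝ) / (n : ℝ) ^ l))
      (∑ k ∈ Finset.range (l + 1), 1 / (n : ℝ) ^ k *
        ((l.descFactorial k : ℝ) * ((Ring.choose ((l : ℤ) - j) k : ℤ) : ℝ) * x ^ (l - k))) := by
  have hn' : (n : ℝ) ≠ 0 := by exact_mod_cast hn.ne'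
  have h1 : HasSum (fun k : ℕ => ∑ i ∈ Finset.range (l + 1), (l.factorial : ℝ) / (n : ℝ) ^ l *
        ((Ring.choose ((l : ℤ) - j) i : ℤ) : ℝ) *
          (szaszBasis n (k : ℤ) x * (k.choose (l - i) : ℝ)))
      (∑ i ∈ Finset.range (l + 1), (l.factorial : ℝ) / (n : ℝ) ^ l *
        ((Ring.choose ((l : ℤ) - j) i : ℤ) : ℝ) *
          (((n : ℝ) * x) ^ (l - i) / ((l - i).factorial : ℝ))) :=
    hasSum_sum fun i _ => (hasSum_szaszBasis_mul_choose n (l - i) x).mul_left _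
  convert h1 using 1
  · funext k
    have h2 := Ring.add_choose_eq l (Commute.all ((l : ℤ) - j) (k : ℤ))
    rw [Finset.Nat.sum_antidiagonal_eq_sum_range_succ_mk] at h2
    rw [show (k : ℤ) - j + l = (l : ℤ) - j + k by ring, h2]
    push_cast
    rw [Finset.mul_sum, Finset.sum_div, Finset.mul_sum]
    refine Finset.sum_congr rfl fun i _ => ?_
    rw [Ring.choose_natCast]
    push_cast
    ring
  · refine Finset.sum_congr rfl fun i hi => ?_
    have hi' := Finset.mem_range_succ_iff.1 hi
    have h3 : (l.factorial : ℝ) = (l - i).factorial * l.descFactorial i := by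
      exact_mod_cast (Nat.factorial_mul_descFactorial hi').symm
    have h4 : ((l - i).factorial : ℝ) ≠ 0 := by positivity
    have h5 : (n : ℝ) ^ l = (n : ℝ) ^ i * (n : ℝ) ^ (l - i) := by
      rw [← pow_add, Nat.add_sub_cancel' hi']
    rw [h3, h5, mul_pow]
    field_simp

theorem szaszExplicitCoeff_pow (k l : ℕ) (j : ℤ) (x : ℝ) :
    szaszExplicitCoeff k 0 j (fun t => t ^ l) x =
      (l.descFactorial k : ℝ) * ((Ring.choose ((l : ℤ) - j) k : ℤ) : ℝ) * x ^ (l - k) := by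
  have hd : ∀ i, iteratedDeriv i (fun t : ℝ => t ^ l) x = (l.descFactorial i : ℝ) * x ^ (l - i) := by
    intro i
    exact iteratedDeriv_pow l i
  rcases lt_or_ge l k with hk | hk
  · rw [Nat.descFactorial_of_lt hk, szaszExplicitCoeff]
    simp only [hd, Nat.cast_zero, zero_mul]
    refine Finset.sum_eq_zero fun i _ => ?_
    rw [Nat.descFactorial_of_lt (by omega), Nat.cast_zero, zero_mul, mul_zero]
  · have h2 := Ring.add_choose_eq k (Commute.all (((l - k : ℕ) : ℤ)) ((k : ℤ) - j))
    rw [Finset.Nat.sum_antidiagonal_eq_sum_range_succ_mk] at h2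
    rw [show (l : ℤ) - j = ((l - k : ℕ) : ℤ) + ((k : ℤ) - j) by omega, h2]
    push_cast
    rw [Finset.mul_sum, Finset.sum_mul, szaszExplicitCoeff]
    refine Finset.sum_congr rfl fun i hi => ?_
    have hi' := Finset.mem_range_succ_iff.1 hi
    have h3 := Nat.descFactorial_mul_descFactorial (n := l) (k := k) (m := k + i) (by omega)
    rw [Nat.add_sub_cancel_left, Nat.descFactorial_eq_factorial_mul_choose] at h3
    rw [hd, add_zero, ← h3, Ring.choose_natCast]
    have h4 : (i.factorial : ℝ) ≠ 0 := by positivity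
    push_cast
    rw [add_zero]
    rcases lt_or_ge (l - k) i with h5 | h5
    · simp [Nat.choose_eq_zero_of_lt h5]
    · rw [show l - k = i + (l - (k + i)) by omega, pow_add]
      field_simp

theorem szaszOp_pow_isBigO (j : ℤ) {x : ℝ} (hx : 0 < x) (l Q : ℕ) :
    (fun n : ℕ => szaszOp n j (fun t => t ^ l) x - ∑ k ∈ Finset.range Q,
        1 / (n : ℝ) ^ k * szaszExplicitCoeff k 0 j (fun t => t ^ l) x)
      =O[atTop] fun n : ℕ => 1 / (n : ℝ) ^ Q := by
  have hgrow : ExpGrowth 1 (fun t : ℝ => t ^ l) := by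
    simpa using expGrowth_polynomial (Polynomial.X ^ l)
  -- the polynomial moment series differs from the operator only in the terms with `k < j`
  have h1 : (fun n : ℕ => ∑ k ∈ Finset.range j.toNat, szaszBasis n (k : ℤ) x *
      ((0 : ℝ) ^ l - (l.factorial : ℝ) * ((Ring.choose ((k : ℤ) - j + l) l : ℤ) : ℝ)
        * (1 / (n : ℝ) ^ l))) =O[atTop] fun n : ℕ => 1 / (n : ℝ) ^ Q := by
    refine IsBigO.fun_sum fun k _ => ?_
    have hb : (fun n : ℕ => (0 : ℝ) ^ l - (l.factorial : ℝ) *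
        ((Ring.choose ((k : ℤ) - j + l) l : ℤ) : ℝ) * (1 / (n : ℝ) ^ l))
        =O[atTop] fun _ => (1 : ℝ) := by
      refine (isBigO_const_const _ one_ne_zero _).sub (IsBigO.const_mul_left ?_ _)
      simpa using isBigO_inv_pow_of_le (Nat.zero_le l)
    simpa using (szaszBasis_isBigO_inv_pow k Q hx).mul hb
  -- the coefficients of order `> l` vanish, so the terms of order `≥ Q` form a finite sum
  have h2 : (fun n : ℕ => ∑ i ∈ Finset.range (l + 1), 1 / (n : ℝ) ^ (Q + i) *
      szaszExplicitCoeff (Q + i) 0 j (fun t => t ^ l) x)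
      =O[atTop] fun n : ℕ => 1 / (n : ℝ) ^ Q := by
    refine IsBigO.fun_sum fun i _ => ?_
    simp only [mul_comm _ (szaszExplicitCoeff _ _ _ _ _)]
    refine IsBigO.const_mul_left ?_ _
    exact isBigO_inv_pow_of_le (Nat.le_add_right Q i)
  refine (h1.add h2).congr' ?_ EventuallyEq.rfl
  filter_upwards [eventually_gt_atTop 1] with n hn
  have hn1 : (1 : ℝ) < n := by exact_mod_cast hn
  have h3 := hasSum_szaszBasis_mul_ringChoose (n := n) (by omega) j l x
  have h4 := (hgrow.summable zero_le_one hn1 j x).hasSum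
  rw [← hgrow.szaszOp_eq zero_le_one hn1] at h4
  have h5 := h4.sub h3
  have h6 := h5.unique (hasSum_sum_of_ne_finset_zero (s := Finset.range j.toNat) ?_)
  · have h7 : ∑ k ∈ Finset.range (l + 1), 1 / (n : ℝ) ^ k *
        ((l.descFactorial k : ℝ) * ((Ring.choose ((l : ℤ) - j) k : ℤ) : ℝ) * x ^ (l - k)) =
        ∑ k ∈ Finset.range (Q + (l + 1)), 1 / (n : ℝ) ^ k *
          szaszExplicitCoeff k 0 j (fun t => t ^ l) x := by
      simp only [szaszExplicitCoeff_pow]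
      refine Finset.sum_subset (Finset.range_mono (by omega)) fun k _ hk => ?_
      rw [Nat.descFactorial_of_lt (by simpa using hk), Nat.cast_zero, zero_mul, zero_mul, mul_zero]
    rw [h7, Finset.sum_range_add] at h6
    rw [sub_eq_iff_eq_add] at h6
    rw [h6]
    have h8 : ∀ k ∈ Finset.range j.toNat, szaszBasis n (k : ℤ) x *
        szaszFunctional n (fun t => t ^ l) ((k : ℤ) - j) - szaszBasis n (k : ℤ) x *
        ((l.factorial : ℝ) * ((Ring.choose ((k : ℤ) - j + l) l : ℤ) : ℝ) / (n : ℝ) ^ l) =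
        szaszBasis n (k : ℤ) x * ((0 : ℝ) ^ l - (l.factorial : ℝ) *
          ((Ring.choose ((k : ℤ) - j + l) l : ℤ) : ℝ) * (1 / (n : ℝ) ^ l)) := by
      intro k hk
      have hk' := Finset.mem_range.1 hk
      rw [szaszFunctional, if_pos (by omega)]
      ring
    rw [Finset.sum_congr rfl h8]
    ring
  · intro k hk
    have hk' : j.toNat ≤ k := by simpa using hk
    rw [szaszFunctional_pow (by omega) l (by omega), sub_self]

theorem szaszExplicitCoeff_congr {k m : ℕ} (j : ℤ) {f g : ℝ → ℝ} {x : ℝ}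
    (h : ∀ i ≤ 2 * k + m, iteratedDeriv i f x = iteratedDeriv i g x) :
    szaszExplicitCoeff k m j f x = szaszExplicitCoeff k m j g x := by
  refine Finset.sum_congr rfl fun i hi => ?_
  have hi' := Finset.mem_range_succ_iff.1 hi
  rw [h _ (by omega)]

theorem iteratedDeriv_polynomial_eval (i : ℕ) (P : Polynomial ℝ) (x : ℝ) :
    iteratedDeriv i (fun t => P.eval t) x = (Polynomial.derivative^[i] P).eval x := by
  induction i generalizing P with
  | zero => simp
  | succ i ih =>
    rw [iteratedDeriv_succ', Function.iterate_succ_apply, ← ih]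
    congr 1
    funext t
    exact P.deriv

/-- On a polynomial the expansion holds to every order: the terms that the operator with `j > 0`
replaces by values at `0` are exponentially small. -/
theorem szaszOp_polynomial_isBigO (j : ℤ) {x : ℝ} (hx : 0 < x) (P : Polynomial ℝ) (Q : ℕ) :
    (fun n : ℕ => szaszOp n j (fun t => P.eval t) x - ∑ k ∈ Finset.range Q,
        1 / (n : ℝ) ^ k * szaszExplicitCoeff k 0 j (fun t => P.eval t) x)
      =O[atTop] fun n : ℕ => 1 / (n : ℝ) ^ Q := by
  induction P using Polynomial.induction_on' with
  | add P R hP hR =>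
    have hc : ∀ k, szaszExplicitCoeff k 0 j (fun t => (P + R).eval t) x =
        szaszExplicitCoeff k 0 j (fun t => P.eval t) x +
          szaszExplicitCoeff k 0 j (fun t => R.eval t) x := by
      intro k
      simp only [szaszExplicitCoeff, iteratedDeriv_polynomial_eval, iterate_map_add]
      simp only [Polynomial.eval_add, mul_add, Finset.sum_add_distrib]
    refine (hP.add hR).congr' ?_ EventuallyEq.rfl
    filter_upwards [eventually_gt_atTop 1] with n hn
    have hn1 : (1 : ℝ) < n := by exact_mod_cast hn
    simp only [hc, mul_add, Finset.sum_add_distrib]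
    simp only [Polynomial.eval_add]
    rw [szaszOp_add n j zero_le_one (expGrowth_polynomial P) (expGrowth_polynomial R) hn1]
    ring
  | monomial l a =>
    have hgrow : ExpGrowth 1 (fun t : ℝ => t ^ l) := by
      simpa using expGrowth_polynomial (Polynomial.X ^ l)
    have hc : ∀ k, szaszExplicitCoeff k 0 j (fun t => a * t ^ l) x =
        a * szaszExplicitCoeff k 0 j (fun t => t ^ l) x := by
      intro k
      simp only [szaszExplicitCoeff, iteratedDeriv_const_mul_field, Finset.mul_sum]
      exact Finset.sum_congr rfl fun i _ => by ring
    simp only [Polynomial.eval_monomial, hc]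
    refine ((szaszOp_pow_isBigO j hx l Q).const_mul_left a).congr' ?_ EventuallyEq.rfl
    filter_upwards [eventually_gt_atTop 1] with n hn
    have hn1 : (1 : ℝ) < n := by exact_mod_cast hn
    rw [szaszOp_const_mul n j zero_le_one hgrow hn1, mul_sub, Finset.mul_sum]
    congr 1
    exact Finset.sum_congr rfl fun i _ => by ring

theorem eval_iterate_derivative_taylor (P : Polynomial ℝ) (x : ℝ) (i : ℕ) :
    (Polynomial.derivative^[i] (Polynomial.taylor (-x) P)).eval x = i.factorial * P.coeff i := by
  have h : (Polynomial.taylor x (Polynomial.taylor (-x) P)).coeff i = P.coeff i := by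
    rw [Polynomial.taylor_taylor, add_neg_cancel, Polynomial.taylor_zero]
  rw [Polynomial.taylor_coeff] at h
  have h2 := congrArg (fun φ => φ (Polynomial.taylor (-x) P))
    (Polynomial.factorial_smul_hasseDeriv (R := ℝ) (k := i))
  simp only [LinearMap.smul_apply] at h2
  rw [← h2, Polynomial.eval_smul, h, nsmul_eq_mul]

theorem exists_polynomial_iterate_derivative (a : ℕ → ℝ) (N : ℕ) (x : ℝ) :
    ∃ T : Polynomial ℝ, ∀ i ≤ N, (Polynomial.derivative^[i] T).eval x = a i := by
  refine ⟨Polynomial.taylor (-x) (∑ l ∈ Finset.range (N + 1),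
    Polynomial.C (a l / (l.factorial : ℝ)) * Polynomial.X ^ l), fun i hi => ?_⟩
  rw [eval_iterate_derivative_taylor]
  have : (i.factorial : ℝ) ≠ 0 := by positivity
  simp [Polynomial.coeff_X_pow, Nat.lt_succ_of_le hi]
  field_simp

theorem szaszOp_central_moment_isBigO (j : ℤ) {x : ℝ} (hx : 0 < x) (r : ℕ) :
    (fun n : ℕ => szaszOp n j (fun t => (t - x) ^ (2 * r)) x)
      =O[atTop] fun n : ℕ => 1 / (n : ℝ) ^ r := by
  have e : ∀ t : ℝ, (Polynomial.taylor (-x) (Polynomial.X ^ (2 * r) : Polynomial ℝ)).eval t =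
      (t - x) ^ (2 * r) := by
    intro t
    simp [sub_eq_add_neg]
  have h := szaszOp_polynomial_isBigO j hx
    (Polynomial.taylor (-x) (Polynomial.X ^ (2 * r) : Polynomial ℝ)) r
  have hz : ∀ n : ℕ, ∑ k ∈ Finset.range r, 1 / (n : ℝ) ^ k * szaszExplicitCoeff k 0 j (fun t =>
      (Polynomial.taylor (-x) (Polynomial.X ^ (2 * r) : Polynomial ℝ)).eval t) x = 0 := by
    intro n
    refine Finset.sum_eq_zero fun k hk => ?_
    have hk' := Finset.mem_range.1 hk
    rw [szaszExplicitCoeff, Finset.sum_eq_zero, mul_zero]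
    intro i hi
    have hi' := Finset.mem_range_succ_iff.1 hi
    rw [iteratedDeriv_polynomial_eval, eval_iterate_derivative_taylor, Polynomial.coeff_X_pow,
      if_neg (by omega), mul_zero, mul_zero]
  simp only [hz, sub_zero] at h
  simpa only [e] using h

/-! ### Localization -/

theorem isLittleO_inv_pow_succ (q : ℕ) :
    (fun n : ℕ => 1 / (n : ℝ) ^ (q + 1)) =o[atTop] fun n : ℕ => 1 / (n : ℝ) ^ q := by
  have h : (fun n : ℕ => 1 / (n : ℝ)) =o[atTop] fun _ => (1 : ℝ) :=
    (isLittleO_one_iff ℝ).2 tendsto_one_div_atTop_nhds_zero_nat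
  have h2 := h.mul_isBigO (isBigO_refl (fun n : ℕ => 1 / (n : ℝ) ^ q) atTop)
  refine h2.congr (fun n => ?_) (fun n => one_mul _)
  rw [pow_succ']
  ring

/-- The weighted mean inequality `e^{At} ≤ N⁻¹ e^{2At} + N ((t - x)/δ)^{4s}` away from `x`, which
separates the exponential factor from the moments. -/
theorem exp_le_of_le_abs_sub {A N δ x t : ℝ} (hN : 0 < N) (hδ : 0 < δ) (ht : δ ≤ |t - x|) (s : ℕ) :
    Real.exp (A * t) ≤
      1 / N * Real.exp (2 * A * t) + N / δ ^ (2 * (2 * s)) * (t - x) ^ (2 * (2 * s)) := by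
  set a := Real.exp (A * t) with ha
  set w := ((t - x) / δ) ^ (2 * s) with hw
  have ha2 : Real.exp (2 * A * t) = a ^ 2 := by
    rw [ha, ← Real.exp_nat_mul]
    congr 1
    push_cast
    ring
  have hw2 : N / δ ^ (2 * (2 * s)) * (t - x) ^ (2 * (2 * s)) = N * w ^ 2 := by
    rw [hw, ← pow_mul, div_pow, mul_comm (2 * s) 2]
    ring
  have hw1 : 1 ≤ w := by
    rw [hw, pow_mul, ← sq_abs, abs_div, abs_of_pos hδ]
    have h1 : 1 ≤ |t - x| / δ := by rwa [one_le_div hδ]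
    exact one_le_pow₀ (one_le_pow₀ h1)
  have ha0 : 0 < a := Real.exp_pos _
  rw [ha2, hw2]
  have h2 : a * w ≤ 1 / N * a ^ 2 + N * w ^ 2 := by
    have h3 : 1 / N * a ^ 2 + N * w ^ 2 - a * w = ((a - N * w) ^ 2 + N * (a * w)) / N := by
      field_simp
      ring
    have h4 : 0 ≤ ((a - N * w) ^ 2 + N * (a * w)) / N := by positivity
    linarith
  exact (le_mul_of_one_le_right ha0.le hw1).trans h2

theorem ExpGrowth.szaszOp_isLittleO (j : ℤ) {x : ℝ} (hx : 0 < x) {A : ℝ} (hA : 0 ≤ A)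
    {R : ℝ → ℝ} (hR : ExpGrowth A R) (q : ℕ) (h : R =o[𝓝 x] fun t => (t - x) ^ (2 * q)) :
    (fun n : ℕ => szaszOp n j R x) =o[atTop] fun n : ℕ => 1 / (n : ℝ) ^ q := by
  obtain ⟨K, hK, hRK⟩ := hR.2
  obtain ⟨C, hC, hmom⟩ := (szaszOp_central_moment_isBigO j hx q).exists_pos
  rw [isLittleO_iff]
  intro c hc
  obtain ⟨δ, hδ, hball⟩ := Metric.eventually_nhds_iff_ball.1
    (isLittleO_iff.1 h (show 0 < c / (2 * C) by positivity))
  set B : ℝ := max (2 * A) 1 with hB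
  have hB0 : 0 ≤ B := le_max_of_le_right zero_le_one
  have gpow : ∀ N : ℕ, ExpGrowth B (fun t => (t - x) ^ N) := by
    intro N
    have := (expGrowth_polynomial ((Polynomial.X - Polynomial.C x) ^ N)).mono (le_max_right (2 * A) 1)
    simpa using this
  have gexp : ExpGrowth B (fun t => Real.exp (2 * A * t)) :=
    (expGrowth_exp (2 * A)).mono (le_max_left _ _)
  have gR : ExpGrowth B R := hR.mono ((by linarith : A ≤ 2 * A).trans (le_max_left _ _))
  -- the contribution of the points with `|t - x| ≥ δ`
  have hfar : (fun n : ℕ => K * (1 / (n : ℝ) ^ (q + 1) *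
        szaszOp n j (fun t => Real.exp (2 * A * t)) x +
      (n : ℝ) ^ (q + 1) / δ ^ (2 * (2 * (q + 1))) *
        szaszOp n j (fun t => (t - x) ^ (2 * (2 * (q + 1)))) x))
      =o[atTop] fun n : ℕ => 1 / (n : ℝ) ^ q := by
    refine IsBigO.trans_isLittleO ?_ (isLittleO_inv_pow_succ q)
    refine IsBigO.const_mul_left (IsBigO.add ?_ ?_) _
    · simpa using (isBigO_refl (fun n : ℕ => 1 / (n : ℝ) ^ (q + 1)) atTop).mul
        ((expGrowth_exp (2 * A)).szaszOp_isBigO_one j (by positivity) hx.le)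
    · have h1 := ((isBigO_refl (fun n : ℕ => (n : ℝ) ^ (q + 1)) atTop).const_mul_left
        (1 / δ ^ (2 * (2 * (q + 1))))).mul (szaszOp_central_moment_isBigO j hx (2 * (q + 1)))
      refine h1.congr' (Eventually.of_forall fun n => by ring) ?_
      filter_upwards [eventually_gt_atTop 0] with n hn
      have hn' : (n : ℝ) ≠ 0 := by exact_mod_cast hn.ne'
      rw [two_mul (q + 1), pow_add]
      field_simp
      ring
  filter_upwards [hmom.bound, isLittleO_iff.1 hfar (half_pos hc), eventually_gt_atTop 0,
    tendsto_natCast_atTop_atTop.eventually_gt_atTop B] with n h1 h2 hn hnB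
  have hn' : (0 : ℝ) < n := by exact_mod_cast hn
  have hN : (0 : ℝ) < (n : ℝ) ^ (q + 1) := by positivity
  have g1 := (gpow (2 * q)).const_mul (c / (2 * C))
  have g2 := gexp.const_mul (1 / (n : ℝ) ^ (q + 1))
  have g3 := (gpow (2 * (2 * (q + 1)))).const_mul ((n : ℝ) ^ (q + 1) / δ ^ (2 * (2 * (q + 1))))
  have g4 := (g2.add g3).const_mul K
  have hle := abs_szaszOp_le n j hB0 gR (g1.add g4) hnB hx.le (fun t ht => by
    rcases lt_or_ge |t - x| δ with htd | htd
    · have h5 := hball t (by rwa [Metric.mem_ball, Real.dist_eq])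
      rw [Real.norm_eq_abs, Real.norm_of_nonneg (Even.pow_nonneg (even_two_mul q) _)] at h5
      refine h5.trans (le_add_of_nonneg_right ?_)
      have h6 := Even.pow_nonneg (even_two_mul (2 * (q + 1))) (t - x)
      positivity
    · refine (hRK t ht).trans (le_trans ?_ (le_add_of_nonneg_left ?_))
      · exact mul_le_mul_of_nonneg_left (exp_le_of_le_abs_sub hN hδ htd (q + 1)) hK.le
      · have h6 := Even.pow_nonneg (even_two_mul q) (t - x)
        positivity)
  rw [szaszOp_add n j hB0 g1 g4 hnB, szaszOp_const_mul n j hB0 (gpow (2 * q)) hnB,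
    szaszOp_const_mul n j hB0 (g2.add g3) hnB, szaszOp_add n j hB0 g2 g3 hnB,
    szaszOp_const_mul n j hB0 gexp hnB, szaszOp_const_mul n j hB0 (gpow _) hnB] at hle
  have h7 : c / (2 * C) * szaszOp n j (fun t => (t - x) ^ (2 * q)) x ≤
      c / 2 * ‖1 / (n : ℝ) ^ q‖ := by
    calc _ ≤ c / (2 * C) * (C * ‖1 / (n : ℝ) ^ q‖) :=
          mul_le_mul_of_nonneg_left ((le_abs_self _).trans h1) (by positivity)
      _ = _ := by field_simp
  rw [Real.norm_eq_abs]
  have h8 := (le_abs_self _).trans h2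
  linarith

/-! ### The expansion -/

/-- The expansion of `S_{n,j} f` itself: the Taylor polynomial of `f` contributes the main terms,
and the remainder is localized at `x`. -/
theorem ExpGrowth.szaszOp_expansion (j : ℤ) {x : ℝ} (hx : 0 < x) {A : ℝ}
    {f : ℝ → ℝ} (hf : ExpGrowth A f) (q : ℕ) (hd : AdmitsDeriv (2 * q) f x)
    (hc : ContinuousAt f x) :
    (fun n : ℕ => szaszOp n j f x
        - ∑ k ∈ Finset.range (q + 1), 1 / (n : ℝ) ^ k * szaszExplicitCoeff k 0 j f x)
      =o[atTop] fun n : ℕ => 1 / (n : ℝ) ^ q := by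
  obtain ⟨T, hT⟩ := exists_polynomial_iterate_derivative (fun i => iteratedDeriv i f x) (2 * q) x
  have hrem := hd.taylor_isLittleO hc T hT
  set B : ℝ := max A 1 with hB
  have hB0 : 0 ≤ B := le_max_of_le_right zero_le_one
  have gf : ExpGrowth B f := hf.mono (le_max_left _ _)
  have gT : ExpGrowth B (fun t => (-1) * T.eval t) :=
    ((expGrowth_polynomial T).mono (le_max_right _ _)).const_mul _
  have gR := gf.add gT
  have h1 := gR.szaszOp_isLittleO j hx hB0 q (by simpa [← sub_eq_add_neg] using hrem)
  have h2 := (szaszOp_polynomial_isBigO j hx T (q + 1)).trans_isLittleO (isLittleO_inv_pow_succ q)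
  refine (h1.add h2).congr' ?_ EventuallyEq.rfl
  filter_upwards [tendsto_natCast_atTop_atTop.eventually_gt_atTop B] with n hnB
  rw [szaszOp_add n j hB0 gf gT hnB, szaszOp_const_mul n j hB0
    ((expGrowth_polynomial T).mono (le_max_right _ _)) hnB]
  have h3 : ∑ k ∈ Finset.range (q + 1), 1 / (n : ℝ) ^ k * szaszExplicitCoeff k 0 j f x =
      ∑ k ∈ Finset.range (q + 1), 1 / (n : ℝ) ^ k *
        szaszExplicitCoeff k 0 j (fun t => T.eval t) x := by
    refine Finset.sum_congr rfl fun k hk => ?_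
    have hk' := Finset.mem_range_succ_iff.1 hk
    rw [szaszExplicitCoeff_congr j (g := fun t => T.eval t) fun i hi => ?_]
    rw [iteratedDeriv_polynomial_eval, hT i (by omega)]
  rw [h3]
  ring

/-- Each differentiation of the operator costs a factor `n`, so the expansion of order `q` of the
derivative of order `m` comes from the one of order `q + m` of the operator itself. -/
theorem ExpGrowth.iteratedDeriv_szaszOp_expansion {x : ℝ} (hx : 0 < x) {A : ℝ}
    (hA : 0 ≤ A) {f : ℝ → ℝ} (hf : ExpGrowth A f) (hc : ContinuousAt f x) (m : ℕ) :
    ∀ (q : ℕ) (j : ℤ), AdmitsDeriv (2 * q + 2 * m) f x →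
    (fun n : ℕ => iteratedDeriv m (szaszOp n j f) x
        - ∑ k ∈ Finset.range (q + 1), 1 / (n : ℝ) ^ k * szaszExplicitCoeff k m j f x)
      =o[atTop] fun n : ℕ => 1 / (n : ℝ) ^ q := by
  induction m with
  | zero =>
    intro q j hd
    simpa only [iteratedDeriv_zero] using hf.szaszOp_expansion j hx q hd hc
  | succ m ih =>
    intro q j hd
    have hd' : AdmitsDeriv (2 * (q + 1) + 2 * m) f x := by
      rwa [show 2 * (q + 1) + 2 * m = 2 * q + 2 * (m + 1) by ring]
    have h1 := (ih (q + 1) (j - 1) hd').sub (ih (q + 1) j hd')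
    have h2 := (isBigO_refl (fun n : ℕ => (n : ℝ)) atTop).mul_isLittleO h1
    refine h2.congr' ?_ ?_
    · filter_upwards [eventually_gt_atTop 0,
        tendsto_natCast_atTop_atTop.eventually_gt_atTop A] with n hn hnA
      have hn' : (n : ℝ) ≠ 0 := by exact_mod_cast hn.ne'
      rw [(hf.iteratedDeriv_szaszOp hA hnA m j).2 x]
      have h3 : ∑ k ∈ Finset.range (q + 1), 1 / (n : ℝ) ^ k * szaszExplicitCoeff k (m + 1) j f x =
          (n : ℝ) * (∑ k ∈ Finset.range (q + 1 + 1), 1 / (n : ℝ) ^ k *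
              szaszExplicitCoeff k m (j - 1) f x -
            ∑ k ∈ Finset.range (q + 1 + 1), 1 / (n : ℝ) ^ k * szaszExplicitCoeff k m j f x) := by
        rw [← Finset.sum_sub_distrib, Finset.sum_range_succ' _ (q + 1), szaszExplicitCoeff_order_zero,
          szaszExplicitCoeff_order_zero, sub_self, add_zero, Finset.mul_sum]
        refine Finset.sum_congr rfl fun k _ => ?_
        rw [← mul_sub, szaszExplicitCoeff_sub, pow_succ]
        field_simp
      rw [h3]
      ring
    · filter_upwards [eventually_gt_atTop 0] with n hn
      have hn' : (n : ℝ) ≠ 0 := by exact_mod_cast hn.ne'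
      rw [pow_succ]
      field_simp

theorem mainTheorem2 (j : ℤ) (q m : ℕ) (x : ℝ) (hx : 0 < x) (f : ℝ → ℝ) (hf : MemE f)
    (hderiv : AdmitsDeriv (2 * q + 2 * m) f x)
    (hcont : q = 0 → m = 0 → ContinuousAt f x) :
    -- `S_{n,j} f` is well defined and `m` times differentiable at `x` for `n > A`, if `f ∈ E_A`
    (∀ A : ℝ, 0 ≤ A → ExpGrowth A f → ∀ n : ℕ, A < (n : ℝ) →
      SzaszOpDefined n j f ∧ AdmitsDeriv m (szaszOp n j f) x) ∧
    -- the coefficients: existence of all derivatives involved, and their explicit form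
    (∀ k : ℕ, k ≤ q →
      (∀ y : ℝ, 0 < y → szaszCoeff k j f y = 1 / (k.factorial : ℝ) *
        (y ^ j * iteratedDeriv k (fun t : ℝ => t ^ ((k : ℤ) - j) * iteratedDeriv k f t) y)) ∧
      AdmitsDeriv (k + m) (fun t : ℝ => t ^ ((k : ℤ) - j) * iteratedDeriv k f t) x ∧
      AdmitsDeriv m (szaszCoeff k j f) x ∧
      iteratedDeriv m (szaszCoeff k j f) x = szaszExplicitCoeff k m j f x) ∧
    -- the asymptotic expansion
    ((fun n : ℕ => iteratedDeriv m (szaszOp n j f) x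
        - ∑ k ∈ Finset.range (q + 1), iteratedDeriv m (szaszCoeff k j f) x / (n : ℝ) ^ k)
      =o[atTop] (fun n : ℕ => 1 / (n : ℝ) ^ q)) ∧
    -- the same in explicit form
    ((fun n : ℕ => iteratedDeriv m (szaszOp n j f) x
        - ∑ k ∈ Finset.range (q + 1), 1 / (n : ℝ) ^ k * szaszExplicitCoeff k m j f x)
      =o[atTop] (fun n : ℕ => 1 / (n : ℝ) ^ q)) := by
  obtain ⟨A, hA, hfA⟩ := hf
  have hc : ContinuousAt f x := by
    rcases Nat.eq_zero_or_pos (2 * q + 2 * m) with h0 | h0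
    · exact hcont (by omega) (by omega)
    · simpa using (hderiv.differentiableAt h0).continuousAt
  have hexp := hfA.iteratedDeriv_szaszOp_expansion hx hA hc m q j hderiv
  have hcoeff : ∀ k ≤ q, AdmitsDeriv m (szaszCoeff k j f) x ∧
      iteratedDeriv m (szaszCoeff k j f) x = szaszExplicitCoeff k m j f x := fun k hk =>
    szaszCoeff_iteratedDeriv j m hx (hderiv.mono (by omega))
  refine ⟨fun A hA hfA n hn => ⟨hfA.szaszOpDefined hA hn j, hfA.admitsDeriv_szaszOp hA hn m j x⟩,
    fun k hk => ⟨fun y hy => szaszCoeff_of_pos k j f hy,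
      (admitsDeriv_zpow_mul j hx (k + m) (hderiv.mono (by omega))).1, hcoeff k hk⟩, ?_, hexp⟩
  refine hexp.congr_left fun n => ?_
  congr 1
  refine Finset.sum_congr rfl fun k hk => ?_
  rw [(hcoeff k (Finset.mem_range_succ_iff.1 hk)).2]
  ring
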